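/- Let $n \ge 0$ be an integer and let $f:\mathbb{C}\to\mathbb{P}^n$ be a holomorphic map into complex projective space of dimension $n$. Suppose that $f$ omits $2n+1$ hypersurfaces $H_1,\dots,H_{2n+1}$ of $\mathbb{P}^n$ (that is, $f(\mathbb{C})\cap H_j=\emptyset$ for every $j$) such that any $n+1$ of them have empty intersection: $\bigcap_{j\in I}H_j=\emptyset$ for every $I\subset\{1,\dots,2n+1\}$ with $\operatorname{card} I=n+1$. Then $f$ is constant. Here a hypersurface is the zero set in $\mathbb{P}^n$ of a nonzero homogeneous polynomial of positive degree in $n+1$ variables with complex coefficients; the degrees of $H_1,\dots,H_{2n+1}$ may differ. -/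

import Mathlib

open scoped Topology LinearAlgebra.Projectivization

/-- Complex projective space of dimension `n`: the lines through the origin of `ℂ^(n+1)`. -/
abbrev CPn (n : ℕ) : Type := ℙ ℂ (Fin (n + 1) → ℂ)

/-- A map `f : ℂ → ℙⁿ` is holomorphic: near every point it is given by homogeneous coordinates
`(F₀ : … : Fₙ)` that are holomorphic functions without common zeros. -/
def IsHolomorphicCurve {n : ℕ} (f : ℂ → CPn n) : Prop :=
  ∀ z₀ : ℂ, ∃ F : ℂ → Fin (n + 1) → ℂ, AnalyticAt ℂ F z₀ ∧
    ∀ᶠ z in 𝓝 z₀, ∃ hz : F z ≠ 0, f z = Projectivization.mk ℂ (F z) hz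

/-- The zero locus in `ℙⁿ` of a polynomial `P` in `n + 1` variables: the set of points all of whose
homogeneous coordinate vectors are zeros of `P`. For homogeneous `P` one such vector suffices, see
`mk_mem_projZeroLocus_iff`. -/
def projZeroLocus {n : ℕ} (P : MvPolynomial (Fin (n + 1)) ℂ) : Set (CPn n) :=
  {p | ∀ (v : Fin (n + 1) → ℂ) (hv : v ≠ 0),
    p = Projectivization.mk ℂ v hv → MvPolynomial.eval v P = 0}

/-- A hypersurface of `ℙⁿ`: the zero locus of a nonzero homogeneous polynomial of positive
degree. -/
def IsHypersurface {n : ℕ} (H : Set (CPn n)) : Prop :=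
  ∃ (d : ℕ) (P : MvPolynomial (Fin (n + 1)) ℂ),
    0 < d ∧ P ≠ 0 ∧ P.IsHomogeneous d ∧ H = projZeroLocus P

theorem mk_mem_projZeroLocus_iff {n d : ℕ} {P : MvPolynomial (Fin (n + 1)) ℂ}
    (hP : P.IsHomogeneous d) (v : Fin (n + 1) → ℂ) (hv : v ≠ 0) :
    Projectivization.mk ℂ v hv ∈ projZeroLocus P ↔ MvPolynomial.eval v P = 0 := by
  refine ⟨fun h => h v hv rfl, fun h w hw hvw => ?_⟩
  obtain ⟨a, ha⟩ := (Projectivization.mk_eq_mk_iff' ℂ w v hw hv).1 hvw.symm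
  suffices hs : MvPolynomial.eval (a • v) P = a ^ d * MvPolynomial.eval v P by
    rw [← ha, hs, h, mul_zero]
  simp only [MvPolynomial.eval_eq', Finset.mul_sum]
  refine Finset.sum_congr rfl fun m hm => ?_
  have hdeg : ∑ i, m i = d := by
    have := hP (MvPolynomial.mem_support_iff.1 hm)
    simpa [Finsupp.weight_apply, Finsupp.sum_fintype] using this
  simp only [Pi.smul_apply, smul_eq_mul, mul_pow, Finset.prod_mul_distrib,
    Finset.prod_pow_eq_pow_sum, hdeg]
  ring

/-!
That the curve is constant follows from Harnack's inequality and a normal family argument, in the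
spirit of J. Lewis's proof of Picard's theorem.

Raise the defining forms to powers so that they have a common degree `D`, and call them `P_j`. By
compactness of the unit sphere, at every point of projective space a strict majority of the `2n + 1`
values `|P_j|` is comparable to `‖v‖ ^ D` (`exists_majority_le_norm_eval`). Along the curve the
quotients `P_j / P_0` are entire functions without zeros, so they are `exp φ_j` with `φ_j` entire,
and at every point of the plane a strict majority of the harmonic functions `Re φ_j` is within a
constant of their maximum (`MajorityMax`).

The heart of the proof is `exists_dominating`: on a disc, such a family has a single member which is
within a constant of the maximum on a smaller concentric disc, the constant and the ratio of the
radii being universal. The proof is an induction on the number of functions. Fix an index `i`, let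
`Z` be the set where `Re φ_i` is almost maximal, and call the amount by which it falls short of the
maximum its gap. Off `Z` the other functions have the majority property, so by induction the gap is
locally comparable to a positive harmonic function and obeys Harnack's inequality. If the gap is
large somewhere near a point of `Z`, then it grows by any given factor on a larger disc
(`exists_forall_exists_mul_gap_lt`): otherwise rescaling yields in the limit harmonic functions with
the majority property without error; since any two strict majorities intersect, their maximum is
one of these functions (`MajorityMax.exists_forall_re_le`), hence harmonic, nonnegative and zero at
the centre, but not identically zero. Following the gap back towards `Z` by Harnack's inequality
then gives a point with at least twice the gap and half the distance to `Z`, and iterating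
contradicts continuity (`lt_of_harnack_of_growth`).

On the whole plane it follows that one `|P_i|` is bounded below by a constant times `‖v‖ ^ D` along
the curve. All quotients of monomials of degree `D` by `P_i` are then bounded entire functions, and
Liouville's theorem makes the curve constant.
-/

open Filter Metric Set

/-! ### Harnack's inequality and a normal family argument -/

/-- A form of Harnack's inequality: where `Re g ≥ 0`, the function `g` varies over the concentric
disc of a fifth of the radius by at most half of the value of `Re g` at the centre. -/
theorem norm_sub_le_half_re_of_re_nonneg {g : ℂ → ℂ} {y z : ℂ} {R : ℝ}
    (hg : DifferentiableOn ℂ g (ball y R)) (hpos : ∀ w ∈ ball y R, 0 ≤ (g w).re)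
    (hR : 0 < R) (hz : dist z y ≤ R / 5) : ‖g z - g y‖ ≤ (g y).re / 2 := by
  have hy0 : 0 ≤ (g y).re := hpos y (mem_ball_self hR)
  have hmaps : ∀ w ∈ ball (0 : ℂ) R, y + w ∈ ball y R := fun w hw => by simpa using hw
  have key : ∀ M : ℝ, 0 < M → (g y).re ≤ M → ‖g z - g y‖ ≤ M / 2 := by
    intro M hM hyM
    have hzn : ‖z - y‖ ≤ R / 5 := by rwa [← dist_eq_norm]
    have hd : DifferentiableOn ℂ (fun w => g y - g (y + w)) (ball 0 R) := by
      refine (differentiableOn_const _).sub (hg.comp (by fun_prop) hmaps)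
    have h := Complex.borelCaratheodory_zero (f := fun w => g y - g (y + w)) (z := z - y)
      (R := R) hM hd (fun w hw => by
        have := hpos _ (hmaps w hw)
        simp only [mem_ofPred_eq, Complex.sub_re]
        linarith) hR (by simp only [mem_ball_zero_iff]; linarith) (by simp)
    simp only [add_sub_cancel] at h
    rw [norm_sub_rev]
    refine h.trans ?_
    rw [div_le_iff₀ (by linarith)]
    nlinarith
  refine le_of_forall_pos_le_add fun ε hε => ?_
  have := key ((g y).re + ε) (by linarith) (by linarith)
  linarith

/-- **Montel's theorem**, for limits along an ultrafilter. -/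
theorem exists_tendstoLocallyUniformlyOn_of_bounded {α : Type*} (l : Ultrafilter α)
    {F : α → ℂ → ℂ} {U : Set ℂ} {R : ℝ} (hU : IsOpen U)
    (hF : ∀ k, DifferentiableOn ℂ (F k) U) (hR : ∀ k, ∀ z ∈ U, ‖F k z‖ ≤ R) :
    ∃ f : ℂ → ℂ, DifferentiableOn ℂ f U ∧ TendstoLocallyUniformlyOn F f (l : Filter α) U := by
  have hlim : ∀ z : ℂ, ∃ w : ℂ, z ∈ U → Tendsto (fun k => F k z) l (𝓝 w) := by
    intro z
    by_cases hz : z ∈ U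
    · obtain ⟨w, -, hw⟩ := (isCompact_closedBall (0 : ℂ) R).ultrafilter_le_nhds
        (l.map fun k => F k z) (by
          simp only [Ultrafilter.coe_map, le_principal_iff, mem_map]
          exact univ_mem' fun k => by simpa using hR k z hz)
      exact ⟨w, fun _ => hw⟩
    · exact ⟨0, fun h => absurd h hz⟩
  choose f hf using hlim
  suffices h : TendstoLocallyUniformlyOn F f (l : Filter α) U from
    ⟨f, h.differentiableOn (Eventually.of_forall hF) hU, h⟩
  rw [Metric.tendstoLocallyUniformlyOn_iff]
  intro ε hε x hx
  obtain ⟨δ, hδ, hball⟩ := Metric.isOpen_iff.1 hU x hx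
  have hR0 : 0 ≤ R ∨ IsEmpty α := by
    by_cases h : Nonempty α
    · exact Or.inl ((norm_nonneg _).trans (hR h.some x hx))
    · exact Or.inr (not_nonempty_iff.1 h)
  rcases hR0 with hR0 | hemp
  swap
  · exact ⟨U, self_mem_nhdsWithin, Eventually.of_forall fun k => (hemp.false k).elim⟩
  -- the Schwarz lemma makes the family equi-Lipschitz at `x`
  have hlip : ∀ k, ∀ z ∈ ball x δ, dist (F k z) (F k x) ≤ (2 * R + 1) / δ * dist z x := by
    intro k z hz
    refine Complex.dist_le_div_mul_dist_of_mapsTo_ball ((hF k).mono hball) (fun w hw => ?_) hz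
    have h1 := hR k w (hball hw)
    have h2 := hR k x hx
    have := norm_sub_le (F k w) (F k x)
    rw [mem_closedBall, dist_eq_norm]
    linarith
  set c : ℝ := (2 * R + 1) / δ with hc
  have hc0 : 0 < c := by positivity
  have hlipf : ∀ z ∈ ball x δ, dist (f z) (f x) ≤ c * dist z x := fun z hz =>
    le_of_tendsto ((hf z (hball hz)).dist (hf x hx)) (Eventually.of_forall fun k => hlip k z hz)
  refine ⟨ball x (min δ (ε / (3 * c))), mem_nhdsWithin_of_mem_nhds
    (ball_mem_nhds _ (by positivity)), ?_⟩
  filter_upwards [(Metric.tendsto_nhds.1 (hf x hx)) (ε / 3) (by positivity)] with k hk z hz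
  have hz1 : z ∈ ball x δ := ball_subset_ball (min_le_left _ _) hz
  have hz2 : c * dist z x < ε / 3 := by
    have : dist z x < ε / (3 * c) := lt_of_lt_of_le hz (min_le_right _ _)
    calc c * dist z x < c * (ε / (3 * c)) := by gcongr
      _ = ε / 3 := by field_simp
  have h1 := hlip k z hz1
  have h2 := hlipf z hz1
  have h3 := dist_triangle4 (f z) (f x) (F k x) (F k z)
  rw [dist_comm (f x), dist_comm (F k x) (F k z)] at h3
  linarith

/-- The *majority property* with error `C` on `U`: at every point of `U`, a strict majority of the
harmonic functions `Re φ_j`, `j ∈ s`, lie within `C` of their maximum. -/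
def MajorityMax {ι : Type*} (C : ℝ) (s : Finset ι) (φ : ι → ℂ → ℂ) (U : Set ℂ) : Prop :=
  ∀ z ∈ U, ∃ A ⊆ s, s.card < 2 * A.card ∧ ∀ j ∈ A, ∀ k ∈ s, (φ k z).re ≤ (φ j z).re + C

theorem MajorityMax.mono {ι : Type*} {C : ℝ} {s : Finset ι} {φ : ι → ℂ → ℂ} {U V : Set ℂ}
    (h : MajorityMax C s φ V) (hUV : U ⊆ V) : MajorityMax C s φ U :=
  fun z hz => h z (hUV hz)

/-- Two strict majorities have a common member. -/
theorem Finset.exists_mem_inter_of_card_lt {ι : Type*} {s A B : Finset ι} (hA : A ⊆ s)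
    (hB : B ⊆ s) (hAc : s.card < 2 * A.card) (hBc : s.card < 2 * B.card) :
    ∃ j, j ∈ A ∧ j ∈ B := by
  classical
  by_contra! h
  have hdisj : Disjoint A B := Finset.disjoint_left.2 h
  have := Finset.card_le_card (Finset.union_subset hA hB)
  rw [Finset.card_union_of_disjoint hdisj] at this
  omega

/-- If `Re g` vanishes on a nonempty open subset of a domain, it vanishes identically. -/
theorem re_eq_zero_of_re_eq_zero_on_open {g : ℂ → ℂ} {U V : Set ℂ} (hg : AnalyticOnNhd ℂ g U)
    (hU : IsPreconnected U) (hV : IsOpen V) (hVU : V ⊆ U) (hne : V.Nonempty)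
    (h : ∀ z ∈ V, (g z).re = 0) {z : ℂ} (hz : z ∈ U) : (g z).re = 0 := by
  obtain ⟨v, hv⟩ := hne
  rcases hg.is_constant_or_isOpen hU with ⟨w, hw⟩ | ho
  · rw [hw z hz, ← hw v (hVU hv), h v hv]
  · exfalso
    obtain ⟨ε, hε, hb⟩ := Metric.isOpen_iff.1 (ho V hVU hV) (g v) (mem_image_of_mem g hv)
    obtain ⟨u, hu, hgu⟩ := hb (show g v + (ε / 2 : ℝ) ∈ ball (g v) ε by
      simp [abs_of_pos hε, hε])
    have h1 := h u hu
    rw [hgu, Complex.add_re, h v hv, Complex.ofReal_re] at h1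
    linarith

/-- The minimum principle: if `Re g ≥ 0` on a domain with equality at a point, then `Re g = 0`. -/
theorem re_eq_zero_of_re_nonneg {g : ℂ → ℂ} {U : Set ℂ} (hg : AnalyticOnNhd ℂ g U)
    (hU : IsPreconnected U) (hUo : IsOpen U) (h : ∀ z ∈ U, 0 ≤ (g z).re) {v z : ℂ} (hv : v ∈ U)
    (hv0 : (g v).re = 0) (hz : z ∈ U) : (g z).re = 0 := by
  rcases hg.is_constant_or_isOpen hU with ⟨w, hw⟩ | ho
  · rw [hw z hz, ← hw v hv, hv0]
  · exfalso
    obtain ⟨ε, hε, hb⟩ := Metric.isOpen_iff.1 (ho U Subset.rfl hUo) (g v) (mem_image_of_mem g hv)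
    obtain ⟨u, hu, hgu⟩ := hb (show g v - (ε / 2 : ℝ) ∈ ball (g v) ε by
      simp [abs_of_pos hε, hε])
    have h1 := h u hu
    rw [hgu, Complex.sub_re, hv0, Complex.ofReal_re] at h1
    linarith

/-- With error `0`, the maximum of the `Re φ_j` is one of the functions `Re φ_i`, on the whole
domain: near a point where as few of them as possible are maximal, the set of maximal ones is
constant, so they coincide everywhere, and every other majority shares a member with them. -/
theorem MajorityMax.exists_forall_re_le {ι : Type*} {s : Finset ι} {φ : ι → ℂ → ℂ} {U : Set ℂ}
    (hφ : ∀ j ∈ s, AnalyticOnNhd ℂ (φ j) U) (hU : IsPreconnected U) (hUo : IsOpen U)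
    (hne : U.Nonempty) (h : MajorityMax 0 s φ U) :
    ∃ i ∈ s, ∀ z ∈ U, ∀ k ∈ s, (φ k z).re ≤ (φ i z).re := by
  classical
  -- `A z` is the set of all indices that are maximal at `z`
  let A : ℂ → Finset ι := fun z => s.filter fun j => ∀ k ∈ s, (φ k z).re ≤ (φ j z).re
  have hA : ∀ z ∈ U, s.card < 2 * (A z).card := by
    intro z hz
    obtain ⟨B, hBs, hBc, hB⟩ := h z hz
    have : B ⊆ A z := fun j hj => Finset.mem_filter.2 ⟨hBs hj, fun k hk => by
      simpa using hB j hj k hk⟩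
    have := Finset.card_le_card this
    omega
  obtain ⟨z₀, hz₀, hmin⟩ : ∃ z₀ ∈ U, ∀ z ∈ U, (A z₀).card ≤ (A z).card := by
    obtain ⟨m, ⟨z₀, hz₀, hm⟩, hmin⟩ := WellFounded.has_min Nat.lt_wfRel.wf
      ((fun z => (A z).card) '' U) (hne.image _)
    exact ⟨z₀, hz₀, fun z hz => by
      have := hmin _ (mem_image_of_mem _ hz)
      simp only [← hm] at this
      exact not_lt.1 this⟩
  have hcont : ∀ j ∈ s, ∀ z ∈ U, ContinuousAt (fun z => (φ j z).re) z := fun j hj z hz =>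
    Complex.continuous_re.continuousAt.comp ((hφ j hj) z hz).continuousAt
  have hsub : ∀ᶠ z in 𝓝 z₀, A z ⊆ A z₀ := by
    have : ∀ j ∈ s, ∀ᶠ z in 𝓝 z₀, j ∈ A z → j ∈ A z₀ := by
      intro j hj
      by_cases hjA : j ∈ A z₀
      · exact Eventually.of_forall fun _ _ => hjA
      · obtain ⟨k, hk, hlt⟩ : ∃ k ∈ s, (φ j z₀).re < (φ k z₀).re := by
          by_contra! hcon
          exact hjA (Finset.mem_filter.2 ⟨hj, hcon⟩)
        filter_upwards [(hcont j hj z₀ hz₀).eventually_lt (hcont k hk z₀ hz₀) hlt] with z hz hjz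
        exact absurd ((Finset.mem_filter.1 hjz).2 k hk) (not_le.2 hz)
    filter_upwards [(Finset.eventually_all s).2 this] with z hz j hj
    exact hz j (Finset.mem_filter.1 hj).1 hj
  obtain ⟨V, hVsub, hVo, hz₀V⟩ := _root_.mem_nhds_iff.1 (hsub.and (hUo.mem_nhds hz₀))
  have hAV : ∀ z ∈ V, A z = A z₀ := fun z hz =>
    Finset.eq_of_subset_of_card_le (hVsub hz).1 (hmin z (hVsub hz).2)
  have hAs : ∀ z, A z ⊆ s := fun z => Finset.filter_subset _ _
  have hAmax : ∀ z, ∀ j ∈ A z, ∀ k ∈ s, (φ k z).re ≤ (φ j z).re := fun z j hj =>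
    (Finset.mem_filter.1 hj).2
  have heq : ∀ i ∈ A z₀, ∀ j ∈ A z₀, ∀ z ∈ U, (φ i z).re = (φ j z).re := by
    intro i hi j hj z hz
    have := re_eq_zero_of_re_eq_zero_on_open (g := fun z => φ i z - φ j z)
      ((hφ i (hAs _ hi)).sub (hφ j (hAs _ hj))) hU hVo (fun z hz => (hVsub hz).2) ⟨z₀, hz₀V⟩
      (fun w hw => by
        have hi' := hAmax w i (by rwa [hAV w hw]) j (hAs _ hj)
        have hj' := hAmax w j (by rwa [hAV w hw]) i (hAs _ hi)
        rw [Complex.sub_re]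
        linarith) hz
    rw [Complex.sub_re] at this
    linarith
  obtain ⟨i, hi⟩ : (A z₀).Nonempty := by
    rw [← Finset.card_pos]
    have := hA z₀ hz₀
    omega
  refine ⟨i, hAs _ hi, fun z hz k hk => ?_⟩
  obtain ⟨j, hj₀, hj⟩ := Finset.exists_mem_inter_of_card_lt (hAs z₀) (hAs z) (hA z₀ hz₀) (hA z hz)
  rw [heq i hi j hj₀ z hz]
  exact hAmax z j hj k hk

/-- Bounded families with the majority property cannot have error tending to `0`, a member
identically zero, all members asymptotically at most `0` at the centre, and yet some member not
small somewhere: in the limit, the maximum of the family would be a single nonnegative harmonic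
function vanishing at the centre. -/
theorem false_of_bounded_of_majorityMax {ι : Type*} {s : Finset ι} {i : ι} (hi : i ∈ s)
    {ψ : ℕ → ι → ℂ → ℂ} {R : ℝ} {ε : ℕ → ℝ} {y : ℕ → ℂ}
    (hψ : ∀ k, ∀ j ∈ s, DifferentiableOn ℂ (ψ k j) (ball 0 2))
    (hR : ∀ k, ∀ j ∈ s, ∀ z ∈ ball (0 : ℂ) 2, ‖ψ k j z‖ ≤ R)
    (hε : Tendsto ε atTop (𝓝 0)) (hmaj : ∀ k, MajorityMax (ε k) s (ψ k) (ball 0 2))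
    (hψi : ∀ k, ∀ z ∈ ball (0 : ℂ) 2, (ψ k i z).re = 0)
    (hψ0 : ∀ k, ∀ j ∈ s, (ψ k j 0).re ≤ ε k)
    (hy : ∀ k, y k ∈ closedBall (0 : ℂ) 1) (hψy : ∀ k, ∃ j ∈ s, 1 / 2 ≤ (ψ k j (y k)).re) :
    False := by
  classical
  let l : Ultrafilter ℕ := hyperfilter ℕ
  have hl : (l : Filter ℕ) ≤ atTop := Nat.hyperfilter_le_atTop
  have hlim : ∀ j, ∃ f : ℂ → ℂ, j ∈ s → DifferentiableOn ℂ f (ball 0 2) ∧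
      TendstoLocallyUniformlyOn (fun k => ψ k j) f (l : Filter ℕ) (ball 0 2) := by
    intro j
    by_cases hj : j ∈ s
    · obtain ⟨f, hf⟩ := exists_tendstoLocallyUniformlyOn_of_bounded l isOpen_ball
        (fun k => hψ k j hj) (fun k => hR k j hj)
      exact ⟨f, fun _ => hf⟩
    · exact ⟨0, fun h => absurd h hj⟩
  choose v hv using hlim
  have hre : ∀ j ∈ s, ∀ z ∈ ball (0 : ℂ) 2,
      Tendsto (fun k => (ψ k j z).re) l (𝓝 (v j z).re) := fun j hj z hz =>
    (Complex.continuous_re.tendsto _).comp ((hv j hj).2.tendsto_at hz)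
  have hεl : Tendsto ε l (𝓝 0) := hε.mono_left hl
  have hvan : ∀ j ∈ s, AnalyticOnNhd ℂ (v j) (ball 0 2) := fun j hj =>
    (hv j hj).1.analyticOnNhd isOpen_ball
  -- along an ultrafilter, one and the same majority is maximal
  have hmaj0 : MajorityMax 0 s v (ball 0 2) := by
    intro z hz
    choose A hAs hAc hA using fun k => hmaj k z hz
    obtain ⟨B, hB, hBl⟩ : ∃ B ∈ (s.powerset : Set (Finset ι)), ∀ᶠ k in (l : Filter ℕ), A k = B := by
      have := (Ultrafilter.eventually_exists_mem_iff (f := l) (P := fun B k => A k = B)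
        (Finset.finite_toSet s.powerset)).1
        (Eventually.of_forall fun k => ⟨A k, by simpa using hAs k, rfl⟩)
      exact this
    obtain ⟨k₀, hk₀⟩ := hBl.exists
    refine ⟨B, hk₀ ▸ hAs k₀, hk₀ ▸ hAc k₀, fun j hj k hk => ?_⟩
    have hjs : j ∈ s := (hk₀ ▸ hAs k₀ : B ⊆ s) hj
    refine le_of_tendsto_of_tendsto (hre k hk z hz) ((hre j hjs z hz).add hεl) ?_
    filter_upwards [hBl] with n hn
    exact hA n j (hn ▸ hj) k hk
  obtain ⟨m, hm, hmax⟩ := hmaj0.exists_forall_re_le hvan (convex_ball 0 2).isPreconnected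
    isOpen_ball ⟨0, by simp⟩
  have hvi : ∀ z ∈ ball (0 : ℂ) 2, (v i z).re = 0 := fun z hz =>
    tendsto_nhds_unique (hre i hi z hz) (by simp only [hψi _ z hz]; exact tendsto_const_nhds)
  have h0 : (0 : ℂ) ∈ ball (0 : ℂ) 2 := by simp
  have hm0 : (v m 0).re = 0 := le_antisymm
    (le_of_tendsto_of_tendsto (hre m hm 0 h0) hεl (Eventually.of_forall fun k => hψ0 k m hm))
    (hvi 0 h0 ▸ hmax 0 h0 i hi)
  have hmz : ∀ z ∈ ball (0 : ℂ) 2, (v m z).re = 0 := fun z hz =>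
    re_eq_zero_of_re_nonneg (hvan m hm) (convex_ball 0 2).isPreconnected isOpen_ball
      (fun w hw => hvi w hw ▸ hmax w hw i hi) h0 hm0 hz
  obtain ⟨w, hw, hyw⟩ := (isCompact_closedBall (0 : ℂ) 1).ultrafilter_le_nhds (l.map y) (by
    simp only [Ultrafilter.coe_map, le_principal_iff, mem_map]
    exact univ_mem' hy)
  have hw2 : w ∈ ball (0 : ℂ) 2 := closedBall_subset_ball (by norm_num) hw
  obtain ⟨j, hj, hjl⟩ := (Ultrafilter.eventually_exists_mem_iff (f := l)
    (P := fun j k => 1 / 2 ≤ (ψ k j (y k)).re) (Finset.finite_toSet s)).1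
    (Eventually.of_forall hψy)
  have hlimy : Tendsto (fun k => ψ k j (y k)) l (𝓝 (v j w)) := by
    refine tendsto_comp_of_locally_uniform_limit_within (s := ball 0 2)
      ((hv j hj).1.continuousOn w hw2) ?_ ?_
    · exact tendsto_nhdsWithin_iff.2 ⟨hyw, Eventually.of_forall fun k =>
        closedBall_subset_ball (by norm_num) (hy k)⟩
    · exact fun u hu => (hv j hj).2 u hu w hw2
  have h1 : 1 / 2 ≤ (v j w).re := ge_of_tendsto ((Complex.continuous_re.tendsto _).comp hlimy) hjl
  have h2 := hmax w hw2 j hj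
  rw [hmz w hw2] at h2
  linarith

/-! ### Growth of the gap near a point where an index is almost maximal -/

/-- The amount by which `Re φ_i z` falls short of the maximum of the `Re φ_k z`, `k ∈ s`. The index
`i` takes part in the maximum even if `i ∉ s`, so that the gap is never negative. -/
noncomputable def gap {ι : Type*} [DecidableEq ι] (s : Finset ι) (φ : ι → ℂ → ℂ) (i : ι) (z : ℂ) :
    ℝ :=
  (insert i s).sup' (Finset.insert_nonempty i s) fun k => (φ k z).re - (φ i z).re

section gap

variable {ι : Type*} [DecidableEq ι] {s : Finset ι} {φ : ι → ℂ → ℂ} {i : ι} {z : ℂ}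

theorem re_le_add_gap {k : ι} (hk : k ∈ s) : (φ k z).re ≤ (φ i z).re + gap s φ i z := by
  have := Finset.le_sup' (fun k => (φ k z).re - (φ i z).re) (Finset.mem_insert_of_mem hk (b := i))
  simp only [gap]
  linarith

theorem gap_le {c : ℝ} (hc : 0 ≤ c) (h : ∀ k ∈ s, (φ k z).re ≤ (φ i z).re + c) :
    gap s φ i z ≤ c := by
  refine Finset.sup'_le _ _ fun k hk => ?_
  rcases Finset.mem_insert.1 hk with rfl | hk
  · simpa using hc
  · linarith [h k hk]

theorem exists_gap_eq (hi : i ∈ s) : ∃ k ∈ s, (φ k z).re = (φ i z).re + gap s φ i z := by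
  obtain ⟨k, hk, h⟩ := Finset.exists_mem_eq_sup' (Finset.insert_nonempty i s)
    fun k => (φ k z).re - (φ i z).re
  refine ⟨k, by rwa [Finset.insert_eq_of_mem hi] at hk, ?_⟩
  rw [gap, h]
  ring

theorem continuous_gap (hφ : ∀ j, Differentiable ℂ (φ j)) : Continuous (gap s φ i) := by
  have : ∀ j, Continuous (φ j) := fun j => (hφ j).continuous
  exact Continuous.finset_sup'_apply _ fun k _ => by fun_prop

end gap

/-- A harmonic function bounded above by `K` on the disc of radius `10` and very negative at the
centre is very negative on the disc of radius `2`; otherwise it is bounded there, together with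
the holomorphic function of which it is the real part. -/
theorem re_lt_neg_one_or_norm_le {g : ℂ → ℂ} {K : ℝ} (hg : DifferentiableOn ℂ g (ball 0 10))
    (hK : ∀ z ∈ ball (0 : ℂ) 10, (g z).re ≤ K) (him : (g 0).im = 0) :
    (∀ z ∈ ball (0 : ℂ) 2, (g z).re < -1) ∨ ∀ z ∈ ball (0 : ℂ) 2, ‖g z‖ ≤ 3 * |K| + 4 := by
  have hK0 : (g 0).re ≤ K := hK 0 (by simp)
  have hdist : ∀ z ∈ ball (0 : ℂ) 2, ‖g z - g 0‖ ≤ (K - (g 0).re) / 2 := by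
    intro z hz
    have := norm_sub_le_half_re_of_re_nonneg (g := fun w => (K : ℂ) - g w) (y := 0) (z := z)
      (R := 10) (by fun_prop) (fun w hw => by simpa using hK w hw) (by norm_num)
      (by rw [mem_ball] at hz; linarith)
    rw [norm_sub_rev]
    simpa using this
  by_cases h : (g 0).re < -K - 2
  · refine Or.inl fun z hz => ?_
    have h1 := (Complex.re_le_norm (g z - g 0)).trans (hdist z hz)
    rw [Complex.sub_re] at h1
    linarith
  · refine Or.inr fun z hz => ?_
    have h1 := hdist z hz
    have h2 := norm_sub_norm_le (g z) (g 0)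
    have h3 : ‖g 0‖ = |(g 0).re| := by
      rw [← Complex.re_add_im (g 0), him]
      simp
    have h4 : |(g 0).re| ≤ |K| + 2 := by
      rw [abs_le]
      constructor <;> linarith [le_abs_self K, neg_abs_le K]
    linarith [le_abs_self K]

/-- The gap of an index almost maximal at `x`, once it is large somewhere on a disc about `x`,
grows by any prescribed factor on a ten times larger disc. -/
theorem exists_forall_exists_mul_gap_lt {ι : Type*} [DecidableEq ι] (s : Finset ι) {i : ι}
    (hi : i ∈ s) {C B : ℝ} (hC : 0 ≤ C) (hB : 0 ≤ B) (K : ℝ) :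
    ∃ M : ℝ, 0 < M ∧ ∀ φ : ι → ℂ → ℂ, (∀ j, Differentiable ℂ (φ j)) → ∀ (x : ℂ) (r : ℝ), 0 < r →
      MajorityMax C s φ (ball x (10 * r)) → (∀ k ∈ s, (φ k x).re ≤ (φ i x).re + C) →
      ∀ y ∈ ball x r, M ≤ gap s φ i y + B →
        ∃ y' ∈ ball x (10 * r), K * (gap s φ i y + B) < gap s φ i y' + B := by
  by_contra! hcon
  -- the lower bounds tend to infinity and exceed `C` and `2 * B`, which become negligible
  choose φ hφ x r hr hmaj hx y hy hMy hgap using fun k : ℕ =>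
    hcon (k + 1 + C + 2 * B) (by positivity)
  set M : ℕ → ℝ := fun k => gap s (φ k) i (y k) + B with hM
  have hMk : ∀ k : ℕ, (k : ℝ) + 1 + C + 2 * B ≤ M k := hMy
  have hM0 : ∀ k, 0 < M k := fun k => lt_of_lt_of_le (by positivity) (hMk k)
  -- the affine rescaling of the discs to the unit disc, with the gap at `y k` rescaled to about `1`
  let T : ℕ → ℂ → ℂ := fun k ζ => x k + r k * ζ
  let g : ℕ → ι → ℂ → ℂ := fun k j ζ => ((φ k j (T k ζ) - φ k i (T k ζ)) -
    ((φ k j (x k) - φ k i (x k)).im : ℝ) * Complex.I) / (M k : ℝ)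
  have hT : ∀ k, ∀ ζ ∈ ball (0 : ℂ) 10, T k ζ ∈ ball (x k) (10 * r k) := by
    intro k ζ hζ
    simp only [T, mem_ball, dist_eq_norm, add_sub_cancel_left, norm_mul, Complex.norm_real,
      Real.norm_eq_abs, abs_of_pos (hr k)]
    rw [mem_ball_zero_iff] at hζ
    nlinarith [hr k]
  have hgre : ∀ k j ζ, (g k j ζ).re = ((φ k j (T k ζ)).re - (φ k i (T k ζ)).re) / M k := by
    intro k j ζ
    simp only [g, Complex.div_ofReal_re, Complex.sub_re, Complex.mul_re, Complex.ofReal_re,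
      Complex.I_re, Complex.ofReal_im, Complex.I_im]
    ring
  have hgdiff : ∀ k j, Differentiable ℂ (g k j) := by
    intro k j
    have h1 := hφ k j
    have h2 := hφ k i
    simp only [g, T]
    fun_prop
  have hgK : ∀ k, ∀ j ∈ s, ∀ ζ ∈ ball (0 : ℂ) 10, (g k j ζ).re ≤ K := by
    intro k j hj ζ hζ
    rw [hgre, div_le_iff₀ (hM0 k)]
    have h1 := hgap k (T k ζ) (hT k ζ hζ)
    have h2 := re_le_add_gap (φ := φ k) (i := i) (z := T k ζ) hj
    linarith
  have hgim : ∀ k j, (g k j 0).im = 0 := by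
    intro k j
    simp [g, T]
  have hCM : ∀ k, C / M k < 1 := fun k => by
    rw [div_lt_one (hM0 k)]
    have := hMk k
    have : (0 : ℝ) ≤ k := k.cast_nonneg
    linarith
  -- functions that are very negative never belong to a majority: make them constant
  let P : ℕ → ι → Prop := fun k j => ∀ z ∈ ball (0 : ℂ) 2, (g k j z).re < -1
  classical
  let ψ : ℕ → ι → ℂ → ℂ := fun k j => if P k j then fun _ => -1 else g k j
  have hPi : ∀ k, ¬ P k i := fun k h => by
    have := h 0 (by simp)
    rw [hgre] at this
    simp at this
    linarith
  have hψi : ∀ k, ψ k i = g k i := fun k => if_neg (hPi k)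
  have hmax : ∀ k, ∀ z ∈ ball (0 : ℂ) 2, ∀ j,
      (∀ l ∈ s, (φ k l (T k z)).re ≤ (φ k j (T k z)).re + C) →
      ψ k j = g k j ∧ ∀ l ∈ s, (ψ k l z).re ≤ (ψ k j z).re + C / M k := by
    intro k z hz j hj
    have hj0 : -1 < (g k j z).re := by
      have h1 := hj i hi
      have h2 := hCM k
      have h3 : -(C / M k) ≤ (g k j z).re := by
        rw [hgre, ← neg_div]
        exact div_le_div_of_nonneg_right (by linarith) (hM0 k).le
      linarith
    have hjP : ¬ P k j := fun h => absurd (h z hz) (not_lt.2 hj0.le)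
    have hψj : ψ k j = g k j := if_neg hjP
    refine ⟨hψj, fun l hl => ?_⟩
    rw [hψj]
    by_cases hlP : P k l
    · have : ψ k l = fun _ => -1 := if_pos hlP
      rw [this]
      have : 0 ≤ C / M k := div_nonneg hC (hM0 k).le
      simp only [Complex.neg_re, Complex.one_re]
      linarith
    · have : ψ k l = g k l := if_neg hlP
      rw [this, hgre, hgre, ← add_div]
      exact div_le_div_of_nonneg_right (by linarith [hj l hl]) (hM0 k).le
  have hTball : ∀ k, ∀ z ∈ ball (0 : ℂ) 2, T k z ∈ ball (x k) (10 * r k) := fun k z hz =>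
    hT k z (ball_subset_ball (by norm_num) hz)
  have hTy : ∀ k, T k ((y k - x k) / r k) = y k := fun k => by
    have : (r k : ℂ) ≠ 0 := by exact_mod_cast (hr k).ne'
    simp only [T]
    field_simp
    ring
  have hTynorm : ∀ k, ‖(y k - x k) / (r k : ℂ)‖ ≤ 1 := fun k => by
    rw [norm_div, Complex.norm_real, Real.norm_eq_abs, abs_of_pos (hr k), div_le_one (hr k),
      ← dist_eq_norm]
    exact (mem_ball.1 (hy k)).le
  refine false_of_bounded_of_majorityMax (s := s) (i := i) hi (ψ := ψ) (R := 3 * |K| + 4)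
    (ε := fun k => C / M k) (y := fun k => (y k - x k) / r k) ?_ ?_ ?_ ?_ ?_ ?_ ?_ ?_
  · intro k j _
    by_cases h : P k j
    · simp only [ψ, if_pos h]
      fun_prop
    · simp only [ψ, if_neg h]
      exact (hgdiff k j).differentiableOn
  · intro k j hj z hz
    by_cases h : P k j
    · simp only [ψ, if_pos h, norm_neg, norm_one]
      linarith [abs_nonneg K]
    · simp only [ψ, if_neg h]
      exact (re_lt_neg_one_or_norm_le (hgdiff k j).differentiableOn (hgK k j hj)
        (hgim k j)).resolve_left h z hz
  · refine Tendsto.div_atTop (tendsto_const_nhds) ?_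
    refine tendsto_atTop_mono (fun k => ?_) tendsto_natCast_atTop_atTop
    have := hMk k
    linarith
  · intro k z hz
    obtain ⟨A, hAs, hAc, hA⟩ := hmaj k (T k z) (hTball k z hz)
    exact ⟨A, hAs, hAc, fun j hj => (hmax k z hz j (hA j hj)).2⟩
  · intro k z _
    rw [hψi, hgre, sub_self, zero_div]
  · intro k j hj
    have := (hmax k 0 (by simp) i (by simpa [T] using hx k)).2 j hj
    rwa [hψi, hgre, sub_self, zero_div, zero_add] at this
  · intro k
    simpa using hTynorm k
  · intro k
    obtain ⟨j, hj, hjy⟩ := exists_gap_eq (φ := φ k) (z := y k) hi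
    have hzb : (y k - x k) / (r k : ℂ) ∈ ball (0 : ℂ) 2 := by
      rw [mem_ball_zero_iff]
      linarith [hTynorm k]
    have h1 := (hmax k _ hzb j (fun l hl => by
      rw [hTy, hjy]
      linarith [re_le_add_gap (φ := φ k) (i := i) (z := y k) hl])).1
    refine ⟨j, hj, ?_⟩
    rw [h1, hgre, hTy, hjy, le_div_iff₀ (hM0 k)]
    have := hMk k
    have hk0 : (0 : ℝ) ≤ k := k.cast_nonneg
    simp only [hM] at this ⊢
    linarith

/-! ### The doubling argument -/

/-- Let `q` satisfy a Harnack inequality on discs free of points of `Z`, and grow by a large factor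
near points of `Z` wherever it is at least `M`. Then `q < M` near points of `Z`: otherwise, moving
from a point where `q` has grown back towards `Z`, the Harnack inequality yields a point where `q`
has doubled, much closer to `Z`. Repetition leads to a convergent sequence of points along which
`q` is unbounded. -/
theorem lt_of_harnack_of_growth {q : ℂ → ℝ} {Z : Set ℂ} {a : ℂ} {ρ η M : ℝ} {N : ℕ}
    (hq : Continuous q) (hM : 0 < M) (hη : 0 < η) (hN : 20 / η < N)
    (harnack : ∀ (y : ℂ) (r : ℝ), 0 < r → ball y r ⊆ ball a ρ → Disjoint (ball y r) Z →
      ∀ z ∈ ball y (η * r), q y ≤ 2 * q z)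
    (growth : ∀ x ∈ Z, ∀ r : ℝ, 0 < r → ball x (10 * r) ⊆ ball a ρ → ∀ y ∈ ball x r, M ≤ q y →
      ∃ y' ∈ ball x (10 * r), 2 ^ (N + 1) * q y < q y')
    {x₀ y₀ : ℂ} (hx₀ : x₀ ∈ Z) (hx₀a : x₀ ∈ ball a (ρ / 128)) (hy₀ : y₀ ∈ ball a (ρ / 128)) :
    q y₀ < M := by
  by_contra! hMy₀
  have hρ : 0 < ρ := by
    have : 0 < ρ / 128 := pos_of_mem_ball hx₀a
    linarith
  have hN0 : (0 : ℝ) < N := lt_trans (by positivity) hN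
  have step : ∀ (x y : ℂ) (δ : ℝ), x ∈ Z → 0 < δ → ball x (11 * δ) ⊆ ball a ρ → y ∈ ball x δ →
      M ≤ q y → ∃ x' y' : ℂ, x' ∈ Z ∧ dist x' x < 11 * δ ∧ y' ∈ ball x' (δ / 2) ∧
        2 * q y ≤ q y' := by
    intro x y δ hx hδ hsub hy hMy
    obtain ⟨w, hw, hqw⟩ := growth x hx δ hδ ((ball_subset_ball (by linarith)).trans hsub) y hy hMy
    -- a chain of `N` short steps from `w` to `x`
    let p : ℕ → ℂ := fun k => w + (k / N : ℝ) * (x - w)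
    have hpx : ∀ k : ℕ, k ≤ N → dist (p k) x < 10 * δ := by
      intro k hk
      have : p k - x = ((1 - k / N : ℝ) : ℂ) * (w - x) := by
        simp only [p]
        push_cast
        ring
      have hk1 : (k : ℝ) / N ≤ 1 := by
        rw [div_le_one hN0]
        exact_mod_cast hk
      have hk0 : 0 ≤ (k : ℝ) / N := by positivity
      rw [dist_eq_norm, this, norm_mul, Complex.norm_real, Real.norm_eq_abs,
        abs_of_nonneg (by linarith), ← dist_eq_norm]
      have := mem_ball.1 hw
      nlinarith [dist_nonneg (x := w) (y := x)]
    have hpN : p N = x := by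
      simp only [p, div_self hN0.ne']
      push_cast
      ring
    have hpstep : ∀ k : ℕ, p (k + 1) ∈ ball (p k) (η * (δ / 2)) := by
      intro k
      have : p (k + 1) - p k = ((1 / N : ℝ) : ℂ) * (x - w) := by
        simp only [p]
        push_cast
        ring
      rw [mem_ball, dist_eq_norm, this, norm_mul, Complex.norm_real, Real.norm_eq_abs,
        abs_of_nonneg (by positivity), ← dist_eq_norm, dist_comm, one_div, inv_mul_lt_iff₀ hN0]
      have h1 := mem_ball.1 hw
      have h2 : 20 < N * η := (div_lt_iff₀ hη).1 hN
      nlinarith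
    have hex : ∃ k, ¬ Disjoint (ball (p k) (δ / 2)) Z :=
      ⟨N, not_disjoint_iff.2 ⟨x, by rw [hpN]; exact mem_ball_self (by positivity), hx⟩⟩
    classical
    set k := Nat.find hex with hk
    have hkN : k ≤ N := Nat.find_min' hex
      (not_disjoint_iff.2 ⟨x, by rw [hpN]; exact mem_ball_self (by positivity), hx⟩)
    have hchain : ∀ m ≤ k, q w ≤ 2 ^ m * q (p m) := by
      intro m
      induction m with
      | zero => intro _; simp [p]
      | succ m ih =>
        intro hm
        have h1 := ih (by omega)
        have h2 := harnack (p m) (δ / 2) (by positivity) (fun v hv => hsub (by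
            have h3 := hpx m (by omega)
            have h4 := dist_triangle v (p m) x
            rw [mem_ball] at hv ⊢
            linarith)) (not_not.1 (Nat.find_min hex (by omega))) _ (hpstep m)
        rw [pow_succ]
        nlinarith [pow_pos (two_pos (α := ℝ)) m]
    obtain ⟨x', hx'p, hx'Z⟩ := not_disjoint_iff.1 (Nat.find_spec hex)
    refine ⟨x', p k, hx'Z, ?_, by rwa [mem_ball_comm] at hx'p, ?_⟩
    · have h3 := hpx k hkN
      have h4 := dist_triangle x' (p k) x
      have h5 := mem_ball.1 hx'p
      linarith
    · have h1 := hchain k le_rfl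
      have h2 : (2 : ℝ) ^ k ≤ 2 ^ N := pow_le_pow_right₀ one_le_two hkN
      have hqy : 0 < q y := hM.trans_le hMy
      have hpos : 0 < 2 ^ k * q (p k) := lt_of_lt_of_le (lt_trans (by positivity) hqw) h1
      have hqp : 0 < q (p k) := pos_of_mul_pos_right hpos (by positivity)
      have h3 : 2 ^ (N + 1) * q y ≤ 2 ^ N * q (p k) := by
        calc 2 ^ (N + 1) * q y ≤ 2 ^ k * q (p k) := hqw.le.trans h1
          _ ≤ 2 ^ N * q (p k) := by gcongr
      rw [pow_succ, mul_assoc] at h3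
      exact le_of_mul_le_mul_left h3 (by positivity)
  -- iterate with radii `δ = (ρ / 64) / 2 ^ k`; the points of `Z` move by at most `11 * δ` each time,
  -- so by at most `22 * (ρ / 64)` in all, and the discs involved remain in `ball a ρ`
  have iter : ∀ k : ℕ, ∃ x y : ℂ, x ∈ Z ∧ dist x x₀ ≤ 22 * (ρ / 64) * (1 - (1 / 2) ^ k) ∧
      y ∈ ball x (ρ / 64 * (1 / 2) ^ k) ∧ 2 ^ k * M ≤ q y := by
    intro k
    induction k with
    | zero =>
      refine ⟨x₀, y₀, hx₀, by simp, ?_, by simpa using hMy₀⟩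
      have := dist_triangle_right y₀ x₀ a
      rw [mem_ball] at *
      linarith
    | succ k ih =>
      obtain ⟨x, y, hxZ, hxd, hy, hqy⟩ := ih
      have hp : (0 : ℝ) < (1 / 2) ^ k := by positivity
      have hp1 : (1 / 2 : ℝ) ^ k ≤ 1 := pow_le_one₀ (by norm_num) (by norm_num)
      obtain ⟨x', y', hx'Z, hx'd, hy', hqy'⟩ := step x y (ρ / 64 * (1 / 2) ^ k) hxZ (by positivity)
        (fun v hv => by
          have h1 := dist_triangle4 v x x₀ a
          rw [mem_ball] at *
          nlinarith) hy (le_trans (le_mul_of_one_le_left hM.le (one_le_pow₀ one_le_two)) hqy)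
      refine ⟨x', y', hx'Z, ?_, ?_, ?_⟩
      · have := dist_triangle x' x x₀
        rw [pow_succ]
        nlinarith
      · rw [pow_succ, ← mul_assoc, mul_one_div]
        exact hy'
      · rw [pow_succ]
        linarith
  obtain ⟨b, hb⟩ := (isCompact_closedBall a ρ).bddAbove_image hq.continuousOn
  obtain ⟨k, hk⟩ := pow_unbounded_of_one_lt (b / M) (one_lt_two (α := ℝ))
  obtain ⟨x, y, -, hxd, hy, hqy⟩ := iter k
  rw [div_lt_iff₀ hM] at hk
  have hyb : q y ≤ b := hb (mem_image_of_mem q (by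
    have hp : (0 : ℝ) < (1 / 2) ^ k := by positivity
    have hp1 : (1 / 2 : ℝ) ^ k ≤ 1 := pow_le_one₀ (by norm_num) (by norm_num)
    have h1 := dist_triangle4 y x x₀ a
    rw [mem_closedBall]
    rw [mem_ball] at *
    nlinarith))
  linarith

/-- A family with the majority property on a disc has a member which is maximal, up to a constant,
on a concentric disc, with constants depending only on the index set and on the error.

By induction on the index set: let `i` be a new index. Away from the points where `i` is almost
maximal, the other indices have the majority property, so that one of them is locally almost
maximal, and Harnack's inequality applies to the gap of `i`. Either there are no such points near
the centre, or the doubling argument bounds the gap of `i` there. -/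
theorem exists_dominating {ι : Type*} [DecidableEq ι] {C : ℝ} (hC : 0 ≤ C) (s : Finset ι) :
    ∃ η C' : ℝ, 0 < η ∧ 0 ≤ C' ∧ ∀ φ : ι → ℂ → ℂ, (∀ j, Differentiable ℂ (φ j)) →
      ∀ (a : ℂ) (ρ : ℝ), 0 < ρ → MajorityMax C s φ (ball a ρ) →
        ∃ i ∈ s, ∀ z ∈ ball a (η * ρ), ∀ k ∈ s, (φ k z).re ≤ (φ i z).re + C' := by
  induction s using Finset.induction_on with
  | empty =>
    refine ⟨1, 0, one_pos, le_rfl, fun φ _ a ρ hρ h => ?_⟩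
    obtain ⟨A, hA, hc, -⟩ := h a (mem_ball_self hρ)
    rw [Finset.subset_empty.1 hA] at hc
    simp at hc
  | insert i s his ih =>
    obtain ⟨η₀, L, hη₀, hL, ih⟩ := ih
    have hi : i ∈ insert i s := Finset.mem_insert_self i s
    set η : ℝ := min 1 η₀ with hηdef
    have hη : 0 < η := by positivity
    have hη1 : η ≤ 1 := min_le_left _ _
    obtain ⟨N, hN⟩ := exists_nat_gt (20 / (η / 5))
    -- the constant added to the gap makes the Harnack inequality below homogeneous
    obtain ⟨M, hM, growth⟩ := exists_forall_exists_mul_gap_lt (insert i s) hi hC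
      (B := 2 * (L + C)) (by positivity) (2 ^ (N + 1))
    refine ⟨η / 128, max M (L + C), by positivity, by positivity, fun φ hφ a ρ hρ hmaj => ?_⟩
    let Z : Set ℂ := {z | ∀ k ∈ insert i s, (φ k z).re ≤ (φ i z).re + C}
    -- on a disc that avoids `Z`, the induction hypothesis gives a dominating index
    have hdom : ∀ (y : ℂ) (r : ℝ), 0 < r → ball y r ⊆ ball a ρ → Disjoint (ball y r) Z →
        ∃ j ∈ s, ∀ z ∈ ball y (η * r), ∀ k ∈ insert i s,
          (φ k z).re ≤ (φ j z).re + (L + C) := by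
      intro y r hr hsub hdisj
      have hAs : ∀ z ∈ ball y r, ∃ A ⊆ s, s.card + 1 < 2 * A.card ∧
          ∀ j ∈ A, ∀ k ∈ insert i s, (φ k z).re ≤ (φ j z).re + C := by
        intro z hz
        obtain ⟨A, hA, hAc, hAm⟩ := hmaj z (hsub hz)
        refine ⟨A, fun j hj => ?_, by rwa [Finset.card_insert_of_notMem his] at hAc, hAm⟩
        rcases Finset.mem_insert.1 (hA hj) with rfl | h
        · exact absurd (hAm j hj) (disjoint_left.1 hdisj hz)
        · exact h
      obtain ⟨j, hj, hjd⟩ := ih φ hφ y r hr fun z hz => by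
        obtain ⟨A, hA, hAc, hAm⟩ := hAs z hz
        exact ⟨A, hA, by omega, fun j hj k hk => hAm j hj k (Finset.mem_insert_of_mem hk)⟩
      refine ⟨j, hj, fun z hz k hk => ?_⟩
      have hz1 : z ∈ ball y (η₀ * r) := ball_subset_ball (by gcongr; exact min_le_right _ _) hz
      have hz2 : z ∈ ball y r := by
        refine ball_subset_ball ?_ hz
        nlinarith
      rcases Finset.mem_insert.1 hk with rfl | hk
      · obtain ⟨A, hA, hAc, hAm⟩ := hAs z hz2
        obtain ⟨m, hm⟩ : A.Nonempty := by
          rw [← Finset.card_pos]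
          omega
        have h1 := hAm m hm k hi
        have h2 := hjd z hz1 m (hA hm)
        linarith
      · linarith [hjd z hz1 k hk]
    have hball : ball a (η / 128 * ρ) ⊆ ball a (ρ / 128) := ball_subset_ball (by nlinarith)
    by_cases hZ : Disjoint (ball a (ρ / 128)) Z
    · obtain ⟨j, hj, hjd⟩ := hdom a (ρ / 128) (by positivity)
        (ball_subset_ball (by linarith)) hZ
      refine ⟨j, Finset.mem_insert_of_mem hj, fun z hz k hk => (hjd z ?_ k hk).trans ?_⟩
      · rwa [← mul_div_assoc, mul_div_right_comm]
      · linarith [le_max_right M (L + C)]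
    · obtain ⟨x₀, hx₀a, hx₀Z⟩ := not_disjoint_iff.1 hZ
      refine ⟨i, hi, fun z hz k hk => ?_⟩
      have hlt : gap (insert i s) φ i z + 2 * (L + C) < M := by
        refine lt_of_harnack_of_growth (q := fun z => gap (insert i s) φ i z + 2 * (L + C))
          ((continuous_gap hφ).add continuous_const) hM (η := η / 5) (by positivity) hN ?_ ?_
          hx₀Z hx₀a (hball hz)
        · intro y r hr hsub hdisj w hw
          obtain ⟨j, hj, hjd⟩ := hdom y r hr hsub hdisj
          -- the gap of `i` is within `L + C` of the positive harmonic function `Re g`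
          let g : ℂ → ℂ := fun v => φ j v - φ i v + ((L + C : ℝ) : ℂ)
          have hgre : ∀ v, (g v).re = (φ j v).re - (φ i v).re + (L + C) := fun v => by
            simp [g]
          have hgpos : ∀ v ∈ ball y (η * r), 0 ≤ (g v).re := fun v hv => by
            rw [hgre]
            linarith [hjd v hv i hi]
          have hy : y ∈ ball y (η * r) := mem_ball_self (by positivity)
          have hgd : Differentiable ℂ g := ((hφ j).sub (hφ i)).add_const _
          have h1 := norm_sub_le_half_re_of_re_nonneg (z := w) hgd.differentiableOn hgpos
            (by positivity) (by
              have := mem_ball.1 hw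
              linarith)
          have h2 := (Complex.abs_re_le_norm (g w - g y)).trans h1
          rw [Complex.sub_re] at h2
          have h3 := (abs_le.1 h2).1
          have h4 : gap (insert i s) φ i y ≤ (g y).re := gap_le (hgpos y hy) fun k hk => by
            rw [hgre]
            linarith [hjd y hy k hk]
          have h5 := re_le_add_gap (φ := φ) (i := i) (z := w) (Finset.mem_insert_of_mem hj (b := i))
          have h6 := hgre w
          linarith
        · intro x hx r hr hsub y hy hMy
          exact growth φ hφ x r hr (hmaj.mono hsub) hx y hy hMy
      have h1 := re_le_add_gap (φ := φ) (i := i) (z := z) hk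
      linarith [le_max_left M (L + C)]

/-- Entire functions with the majority property on the whole plane have a member which is maximal
up to a constant on the whole plane. -/
theorem exists_dominating_univ {ι : Type*} {C : ℝ} (hC : 0 ≤ C) {s : Finset ι} {φ : ι → ℂ → ℂ}
    (hφ : ∀ j, Differentiable ℂ (φ j)) (hmaj : MajorityMax C s φ univ) :
    ∃ i ∈ s, ∃ C' : ℝ, ∀ z, ∀ k ∈ s, (φ k z).re ≤ (φ i z).re + C' := by
  classical
  obtain ⟨η, C', hη, -, h⟩ := exists_dominating hC s
  choose i his hi using fun m : ℕ =>
    h φ hφ 0 (m + 1) (by positivity) (hmaj.mono (subset_univ _))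
  -- some index dominates on arbitrarily large discs
  obtain ⟨j, hj⟩ : ∃ j ∈ s, ∃ᶠ m in atTop, i m = j := by
    by_contra! hcon
    obtain ⟨m, hm⟩ := ((Finset.eventually_all s).2 hcon).exists
    exact hm _ (his m) rfl
  refine ⟨j, hj.1, C', fun z k hk => ?_⟩
  obtain ⟨m₀, hm₀⟩ := exists_nat_gt (‖z‖ / η)
  obtain ⟨m, rfl, hm⟩ := (hj.2.and_eventually (eventually_ge_atTop m₀)).exists
  refine hi m z ?_ k hk
  rw [div_lt_iff₀ hη] at hm₀
  have : (m₀ : ℝ) ≤ m := by exact_mod_cast hm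
  rw [mem_ball_zero_iff]
  nlinarith

/-! ### Homogeneous forms -/

section forms

variable {n d : ℕ}

theorem eval_smul_of_isHomogeneous {P : MvPolynomial (Fin (n + 1)) ℂ} (hP : P.IsHomogeneous d)
    (a : ℂ) (v : Fin (n + 1) → ℂ) :
    MvPolynomial.eval (a • v) P = a ^ d * MvPolynomial.eval v P := by
  simp only [MvPolynomial.eval_eq', Finset.mul_sum]
  refine Finset.sum_congr rfl fun m hm => ?_
  have hdeg : ∑ i, m i = d := by
    have := hP (MvPolynomial.mem_support_iff.1 hm)
    simpa [Finsupp.weight_apply, Finsupp.sum_fintype] using this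
  simp only [Pi.smul_apply, smul_eq_mul, mul_pow, Finset.prod_mul_distrib,
    Finset.prod_pow_eq_pow_sum, hdeg]
  ring

/-- The value of a form at `v` is that at a unit vector times a power of the norm. -/
theorem exists_norm_eq_one_norm_eval {v : Fin (n + 1) → ℂ} (hv : v ≠ 0) :
    ∃ w : Fin (n + 1) → ℂ, ‖w‖ = 1 ∧ ∀ (d : ℕ) (P : MvPolynomial (Fin (n + 1)) ℂ),
      P.IsHomogeneous d → ‖MvPolynomial.eval v P‖ = ‖v‖ ^ d * ‖MvPolynomial.eval w P‖ := by
  have hv0 : ‖v‖ ≠ 0 := norm_ne_zero_iff.2 hv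
  refine ⟨((‖v‖ : ℂ)⁻¹) • v, ?_, fun d P hP => ?_⟩
  · rw [norm_smul, norm_inv, Complex.norm_real, norm_norm, inv_mul_cancel₀ hv0]
  · rw [eval_smul_of_isHomogeneous hP, norm_mul, norm_pow, norm_inv, Complex.norm_real, norm_norm,
      ← mul_assoc, ← mul_pow, mul_inv_cancel₀ hv0, one_pow, one_mul]

theorem exists_norm_eval_le {P : MvPolynomial (Fin (n + 1)) ℂ} (hP : P.IsHomogeneous d) :
    ∃ c : ℝ, 0 < c ∧ ∀ v : Fin (n + 1) → ℂ, v ≠ 0 → ‖MvPolynomial.eval v P‖ ≤ c * ‖v‖ ^ d := by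
  obtain ⟨c, hc⟩ := (isCompact_sphere (0 : Fin (n + 1) → ℂ) 1).bddAbove_image
    (f := fun v => ‖MvPolynomial.eval v P‖) (MvPolynomial.continuous_eval P).norm.continuousOn
  refine ⟨max c 1, by positivity, fun v hv => ?_⟩
  obtain ⟨w, hw, hvw⟩ := exists_norm_eq_one_norm_eval hv
  rw [hvw d P hP, mul_comm]
  gcongr
  exact (hc (mem_image_of_mem _ (by simpa using hw))).trans (le_max_left _ _)

/-- If forms of degree `d` have no common zero in projective space, then at each `v` one of them
has absolute value at least a constant times `‖v‖ ^ d`, by compactness of the unit sphere. -/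
theorem exists_le_norm_eval {ι : Type*} {J : Finset ι} {P : ι → MvPolynomial (Fin (n + 1)) ℂ}
    (hP : ∀ j, (P j).IsHomogeneous d)
    (h : ∀ v : Fin (n + 1) → ℂ, v ≠ 0 → ∃ j ∈ J, MvPolynomial.eval v (P j) ≠ 0) :
    ∃ c : ℝ, 0 < c ∧ ∀ v : Fin (n + 1) → ℂ, v ≠ 0 →
      ∃ j ∈ J, c * ‖v‖ ^ d ≤ ‖MvPolynomial.eval v (P j)‖ := by
  have hJ : J.Nonempty := by
    obtain ⟨j, hj, -⟩ := h 1 one_ne_zero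
    exact ⟨j, hj⟩
  let F : (Fin (n + 1) → ℂ) → ℝ := fun v => J.sup' hJ fun j => ‖MvPolynomial.eval v (P j)‖
  have hF : Continuous F := Continuous.finset_sup'_apply _ fun j _ =>
    (MvPolynomial.continuous_eval (P j)).norm
  obtain ⟨v₀, hv₀, hmin⟩ := (isCompact_sphere (0 : Fin (n + 1) → ℂ) 1).exists_isMinOn
    (NormedSpace.sphere_nonempty.2 zero_le_one) hF.continuousOn
  have hv₀1 : ‖v₀‖ = 1 := by simpa using hv₀
  refine ⟨F v₀, ?_, fun v hv => ?_⟩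
  · obtain ⟨j, hj, hne⟩ := h v₀ (norm_ne_zero_iff.1 (by rw [hv₀1]; exact one_ne_zero))
    exact (norm_pos_iff.2 hne).trans_le
      (Finset.le_sup' (fun j => ‖MvPolynomial.eval v₀ (P j)‖) hj)
  · obtain ⟨w, hw, hvw⟩ := exists_norm_eq_one_norm_eval hv
    obtain ⟨j, hj, hjw⟩ := Finset.exists_mem_eq_sup' hJ fun j => ‖MvPolynomial.eval w (P j)‖
    refine ⟨j, hj, ?_⟩
    rw [hvw d _ (hP j), mul_comm, ← hjw]
    gcongr
    exact hmin (by simpa using hw)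

/-- If any `m + 1` of at least `2 * m + 1` forms have no common zero, then at each `v` a strict
majority of them has absolute value at least a constant times `‖v‖ ^ d`. -/
theorem exists_majority_le_norm_eval {ι : Type*} [Fintype ι] {m : ℕ}
    (hι : 2 * m + 1 ≤ Fintype.card ι) {P : ι → MvPolynomial (Fin (n + 1)) ℂ}
    (hP : ∀ j, (P j).IsHomogeneous d)
    (h : ∀ J : Finset ι, J.card = m + 1 → ∀ v : Fin (n + 1) → ℂ, v ≠ 0 →
      ∃ j ∈ J, MvPolynomial.eval v (P j) ≠ 0) :
    ∃ c : ℝ, 0 < c ∧ ∀ v : Fin (n + 1) → ℂ, v ≠ 0 → ∃ A : Finset ι,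
      Fintype.card ι < 2 * A.card ∧ ∀ j ∈ A, c * ‖v‖ ^ d ≤ ‖MvPolynomial.eval v (P j)‖ := by
  classical
  have hJ : ∀ J : Finset ι, ∃ c : ℝ, 0 < c ∧ (J.card = m + 1 → ∀ v : Fin (n + 1) → ℂ, v ≠ 0 →
      ∃ j ∈ J, c * ‖v‖ ^ d ≤ ‖MvPolynomial.eval v (P j)‖) := by
    intro J
    by_cases hc : J.card = m + 1
    · obtain ⟨c, hc0, hcJ⟩ := exists_le_norm_eval hP (h J hc)
      exact ⟨c, hc0, fun _ => hcJ⟩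
    · exact ⟨1, one_pos, fun h => absurd h hc⟩
  choose c hc0 hc using hJ
  let c₀ : ℝ := Finset.univ.inf' Finset.univ_nonempty c
  refine ⟨c₀, (Finset.lt_inf'_iff _).2 fun J _ => hc0 J, fun v hv => ?_⟩
  let A : Finset ι := Finset.univ.filter fun j => c₀ * ‖v‖ ^ d ≤ ‖MvPolynomial.eval v (P j)‖
  refine ⟨A, ?_, fun j hj => (Finset.mem_filter.1 hj).2⟩
  by_contra! hA
  have hAc := Finset.card_compl_add_card A
  obtain ⟨J, hJA, hJc⟩ := Finset.exists_subset_card_eq (s := Aᶜ) (n := m + 1) (by omega)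
  obtain ⟨j, hj, hjv⟩ := hc J hJc v hv
  refine Finset.mem_compl.1 (hJA hj) (Finset.mem_filter.2 ⟨Finset.mem_univ j, le_trans ?_ hjv⟩)
  gcongr
  exact Finset.inf'_le _ (Finset.mem_univ J)

/-- Hypersurfaces `H j` are given by forms of one and the same degree: pass to powers. -/
theorem exists_forms_of_isHypersurface {ι : Type*} [Fintype ι] {H : ι → Set (CPn n)}
    (hH : ∀ j, IsHypersurface (H j)) :
    ∃ (D : ℕ) (P : ι → MvPolynomial (Fin (n + 1)) ℂ), 0 < D ∧ (∀ j, (P j).IsHomogeneous D) ∧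
      ∀ j (v : Fin (n + 1) → ℂ) (hv : v ≠ 0),
        Projectivization.mk ℂ v hv ∈ H j ↔ MvPolynomial.eval v (P j) = 0 := by
  choose d P hd _ hP hHP using hH
  have hdvd : ∀ j, d j ∣ ∏ k, d k := fun j => Finset.dvd_prod_of_mem d (Finset.mem_univ j)
  have hD : 0 < ∏ k, d k := Finset.prod_pos fun k _ => hd k
  refine ⟨∏ k, d k, fun j => P j ^ ((∏ k, d k) / d j), hD, fun j => ?_, fun j v hv => ?_⟩
  · have := (hP j).pow ((∏ k, d k) / d j)
    rwa [Nat.mul_div_cancel' (hdvd j)] at this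
  · rw [hHP j, mk_mem_projZeroLocus_iff (hP j), map_pow, pow_eq_zero_iff]
    exact (Nat.div_pos (Nat.le_of_dvd hD (hdvd j)) (hd j)).ne'

end forms

/-! ### Holomorphic curves and entire functions -/

/-- An entire function without zeros has an entire logarithm. -/
theorem exists_differentiable_exp_eq {g : ℂ → ℂ} (hg : Differentiable ℂ g) (h0 : ∀ z, g z ≠ 0) :
    ∃ φ : ℂ → ℂ, Differentiable ℂ φ ∧ ∀ z, Complex.exp (φ z) = g z := by
  obtain ⟨L, hL⟩ := (Differentiable.div hg.deriv hg h0).isExactOn_univ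
  have hL' : ∀ z, HasDerivAt L (deriv g z / g z) z := fun z => hL z (mem_univ z)
  have hE : ∀ z, HasDerivAt (fun z => Complex.exp (-L z) * g z) 0 z := by
    intro z
    have h1 := ((hL' z).neg.cexp).mul (hg z).hasDerivAt
    refine h1.congr_deriv ?_
    have := h0 z
    simp only [Pi.neg_apply]
    field_simp
    ring
  have hconst := is_const_of_deriv_eq_zero (fun z => (hE z).differentiableAt)
    (fun z => (hE z).deriv)
  refine ⟨fun z => L z + Complex.log (Complex.exp (-L 0) * g 0), fun z =>
    ((hL' z).add_const _).differentiableAt, fun z => ?_⟩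
  rw [Complex.exp_add, Complex.exp_log (mul_ne_zero (Complex.exp_ne_zero _) (h0 0)), hconst 0 z,
    ← mul_assoc, ← Complex.exp_add, add_neg_cancel, Complex.exp_zero, one_mul]

/-- The quotient of two forms of the same degree along a holomorphic curve, the denominator having
no zeros on the curve, is an entire function. It does not depend on the choice of homogeneous
coordinates, so `rep`, though discontinuous, may be used. -/
theorem IsHolomorphicCurve.differentiable_eval_div {n d : ℕ} {f : ℂ → CPn n}
    (hf : IsHolomorphicCurve f) {P Q : MvPolynomial (Fin (n + 1)) ℂ} (hP : P.IsHomogeneous d)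
    (hQ : Q.IsHomogeneous d) (hQ0 : ∀ z, MvPolynomial.eval (f z).rep Q ≠ 0) :
    Differentiable ℂ fun z => MvPolynomial.eval (f z).rep P / MvPolynomial.eval (f z).rep Q := by
  intro z₀
  obtain ⟨F, hF, hfF⟩ := hf z₀
  have han : ∀ R : MvPolynomial (Fin (n + 1)) ℂ,
      AnalyticAt ℂ (fun z => MvPolynomial.eval (F z) R) z₀ := fun R =>
    AnalyticAt.aeval_mvPolynomial (fun i => (analyticAt_pi_iff.1 hF) i) R
  have hrep : ∀ᶠ z in 𝓝 z₀, ∃ a : ℂ, a ≠ 0 ∧ (f z).rep = a • F z := by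
    filter_upwards [hfF] with z ⟨hz, hfz⟩
    obtain ⟨a, ha⟩ := Projectivization.exists_smul_eq_mk_rep ℂ (F z) hz
    exact ⟨a, a.ne_zero, by rw [hfz, ← ha]; rfl⟩
  have hQF : MvPolynomial.eval (F z₀) Q ≠ 0 := by
    obtain ⟨a, ha, h⟩ := hrep.self_of_nhds
    intro h0
    apply hQ0 z₀
    rw [h, eval_smul_of_isHomogeneous hQ, h0, mul_zero]
  refine (((han P).div (han Q) hQF).differentiableAt).congr_of_eventuallyEq ?_
  filter_upwards [hrep] with z ⟨a, ha, h⟩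
  rw [h, eval_smul_of_isHomogeneous hP, eval_smul_of_isHomogeneous hQ, Pi.div_apply,
    mul_div_mul_left _ _ (pow_ne_zero _ ha)]

/-- A holomorphic curve on which one form of positive degree `D` has absolute value at least a
constant times the `D`-th power of the norm is constant: the quotients of monomials of degree `D`
by this form are bounded entire functions. -/
theorem IsHolomorphicCurve.exists_forall_eq_of_le_norm_eval {n D : ℕ} {f : ℂ → CPn n}
    (hf : IsHolomorphicCurve f) (hD : 0 < D) {Q : MvPolynomial (Fin (n + 1)) ℂ}
    (hQ : Q.IsHomogeneous D) {c : ℝ} (hc : 0 < c)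
    (h : ∀ z, c * ‖(f z).rep‖ ^ D ≤ ‖MvPolynomial.eval (f z).rep Q‖) :
    ∃ p : CPn n, ∀ z, f z = p := by
  have hnorm : ∀ z, 0 < ‖(f z).rep‖ := fun z => norm_pos_iff.2 (Projectivization.rep_nonzero _)
  have hQ0 : ∀ z, MvPolynomial.eval (f z).rep Q ≠ 0 := fun z =>
    norm_pos_iff.1 (lt_of_lt_of_le (mul_pos hc (pow_pos (hnorm z) D)) (h z))
  have hconst : ∀ P : MvPolynomial (Fin (n + 1)) ℂ, P.IsHomogeneous D → ∀ z w,
      MvPolynomial.eval (f z).rep P / MvPolynomial.eval (f z).rep Q =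
        MvPolynomial.eval (f w).rep P / MvPolynomial.eval (f w).rep Q := by
    intro P hP
    refine (hf.differentiable_eval_div hP hQ hQ0).apply_eq_apply_of_bounded ?_
    obtain ⟨b, hb, hPb⟩ := exists_norm_eval_le hP
    refine isBounded_iff_forall_norm_le.2 ⟨b / c, ?_⟩
    rintro _ ⟨z, rfl⟩
    rw [norm_div, div_le_div_iff₀ (norm_pos_iff.2 (hQ0 z)) hc]
    calc _ ≤ b * ‖(f z).rep‖ ^ D * c :=
          mul_le_mul_of_nonneg_right (hPb _ (Projectivization.rep_nonzero _)) hc.le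
      _ = b * (c * ‖(f z).rep‖ ^ D) := by ring
      _ ≤ _ := by gcongr; exact h z
  obtain ⟨k, hk⟩ := Function.ne_iff.1 (Projectivization.rep_nonzero (f 0))
  obtain ⟨e, rfl⟩ : ∃ e, D = e + 1 := ⟨D - 1, by omega⟩
  refine ⟨f 0, fun z => ?_⟩
  -- the quotients of the `X m * X k ^ e` by `Q` are homogeneous coordinates of the curve
  have hX : ∀ m, (f z).rep m * (f z).rep k ^ e / MvPolynomial.eval (f z).rep Q =
      (f 0).rep m * (f 0).rep k ^ e / MvPolynomial.eval (f 0).rep Q := by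
    intro m
    have := hconst (MvPolynomial.X m * MvPolynomial.X k ^ e) (by
      have := (MvPolynomial.isHomogeneous_X ℂ m).mul ((MvPolynomial.isHomogeneous_X ℂ k).pow e)
      convert this using 1
      ring) z 0
    simpa using this
  have hkz : (f z).rep k ^ e ≠ 0 := by
    intro h0
    have := hX k
    rw [h0, mul_zero, zero_div, eq_comm, div_eq_zero_iff] at this
    exact this.elim (mul_ne_zero hk (pow_ne_zero _ hk)) (hQ0 0)
  rw [← Projectivization.mk_rep (f z), ← Projectivization.mk_rep (f 0),
    Projectivization.mk_eq_mk_iff']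
  refine ⟨MvPolynomial.eval (f z).rep Q / (f z).rep k ^ e *
    ((f 0).rep k ^ e / MvPolynomial.eval (f 0).rep Q), funext fun m => ?_⟩
  have h1 := hX m
  have h2 := hQ0 z
  have h3 := hQ0 0
  rw [div_eq_iff h2] at h1
  rw [Pi.smul_apply, smul_eq_mul, eq_comm, ← mul_left_inj' hkz, h1]
  field_simp

theorem mainTheorem2 (n : ℕ) (f : ℂ → CPn n) (hf : IsHolomorphicCurve f)
    (H : Fin (2 * n + 1) → Set (CPn n)) (hH : ∀ j, IsHypersurface (H j))
    (hempty : ∀ I : Finset (Fin (2 * n + 1)), I.card = n + 1 → (⋂ j ∈ I, H j) = ∅)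
    (havoid : ∀ (j : Fin (2 * n + 1)) (z : ℂ), f z ∉ H j) :
    ∃ p : CPn n, ∀ z : ℂ, f z = p := by
  obtain ⟨D, P, hD, hP, hHP⟩ := exists_forms_of_isHypersurface hH
  have hP0 : ∀ j z, MvPolynomial.eval (f z).rep (P j) ≠ 0 := by
    intro j z h0
    apply havoid j z
    rwa [← Projectivization.mk_rep (f z), hHP]
  obtain ⟨c, hc, hmaj⟩ := exists_majority_le_norm_eval (m := n)
    (by rw [Fintype.card_fin]) hP (by
      intro J hJ v hv
      by_contra! hcon
      have : Projectivization.mk ℂ v hv ∈ ⋂ j ∈ J, H j :=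
        mem_iInter₂.2 fun j hj => (hHP j v hv).2 (hcon j hj)
      rw [hempty J hJ] at this
      exact this)
  choose b hb0 hb using fun j => exists_norm_eval_le (hP j)
  choose φ hφ hexp using fun j => exists_differentiable_exp_eq
    (hf.differentiable_eval_div (hP j) (hP 0) (hP0 0))
    fun z => div_ne_zero (hP0 j z) (hP0 0 z)
  -- comparing real parts of the logarithms amounts to comparing absolute values of the forms
  have hcmp : ∀ (j k) (z : ℂ) (a : ℝ), (φ k z).re ≤ (φ j z).re + a ↔
      ‖MvPolynomial.eval (f z).rep (P k)‖ ≤ ‖MvPolynomial.eval (f z).rep (P j)‖ * Real.exp a := by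
    intro j k z a
    rw [← Real.exp_le_exp, Real.exp_add, ← Complex.norm_exp, ← Complex.norm_exp, hexp, hexp,
      norm_div, norm_div, div_mul_eq_mul_div,
      div_le_div_iff_of_pos_right (norm_pos_iff.2 (hP0 0 z))]
  let E : ℝ := max 1 ((∑ j, b j) / c)
  have hE : 1 ≤ E := le_max_left _ _
  obtain ⟨i, -, C', hi⟩ := exists_dominating_univ (C := Real.log E) (s := Finset.univ)
    (Real.log_nonneg hE) hφ (by
      intro z _
      obtain ⟨A, hAc, hA⟩ := hmaj (f z).rep (Projectivization.rep_nonzero _)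
      refine ⟨A, Finset.subset_univ A, by rwa [Finset.card_univ], fun j hj k _ => ?_⟩
      rw [hcmp, Real.exp_log (by positivity)]
      calc _ ≤ b k * ‖(f z).rep‖ ^ D := hb k _ (Projectivization.rep_nonzero _)
        _ ≤ (∑ j, b j) * ‖(f z).rep‖ ^ D := by
            gcongr
            exact Finset.single_le_sum (fun j _ => (hb0 j).le) (Finset.mem_univ k)
        _ = c * ‖(f z).rep‖ ^ D * ((∑ j, b j) / c) := by field_simp
        _ ≤ _ := mul_le_mul (hA j hj) (le_max_right _ _)
            (div_nonneg (Finset.sum_nonneg fun j _ => (hb0 j).le) hc.le) (norm_nonneg _))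
  refine hf.exists_forall_eq_of_le_norm_eval hD (hP i) (c := c / Real.exp C') (by positivity)
    fun z => ?_
  obtain ⟨A, hAc, hA⟩ := hmaj (f z).rep (Projectivization.rep_nonzero _)
  obtain ⟨j, hj⟩ : A.Nonempty := by
    rw [← Finset.card_pos]
    omega
  rw [div_mul_eq_mul_div, div_le_iff₀ (Real.exp_pos _)]
  exact (hA j hj).trans ((hcmp i j z C').1 (hi z j (Finset.mem_univ j)))
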